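/- All spaces are real. For a Banach space $G$, let $G^*$ and $G^{**}$ be its dual and bidual and $J_G\colon G\to G^{**}$ the canonical embedding. Duals of Banach lattices carry the dual order ($f\le g$ iff $f(x)\le g(x)$ for all $x\ge 0$). A sequence $(x_n)$ in a Banach lattice is disjoint if $|x_n|\wedge|x_k|=0$ for $n\neq k$. A Banach lattice has the positive Schur property if its positive weakly null sequences are norm null (equivalently, its disjoint weakly null sequences are norm null). An $m$-linear operator from a product of Banach lattices to a Banach lattice is positive if it maps tuples of positive vectors to positive vectors. An $m$-linear operator from a product of Banach lattices to a Banach space is separately almost Dunford-Pettis if, for each $j$, fixing all the variables except the $j$-th arbitrarily yields a linear operator that sends disjoint weakly null sequences to norm null sequences. **Proposition.** Let $E_1,\dots,E_m$ be Banach lattices whose duals $E_1^*,\dots,E_m^*$ have the positive Schur property, let $F$ be a Banach lattice with order continuous norm, and let $A\colon E_1\times\cdots\times E_m\to F$ be a positive $m$-linear operator. Let $\widetilde A\colon E_1^{**}\times\cdots\times E_m^{**}\to F^{**}$ be a continuous positive $m$-linear operator such that 1. $\widetilde A(J_{E_1}x_1,\dots,J_{E_m}x_m)=J_F(A(x_1,\dots,x_m))$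 for all $x_i\in E_i$ (that is, $\widetilde A$ is a bidual extension of $A$); 2. $\widetilde A$ is genuine, that is, $\widetilde A(E_1^{**}\times\cdots\times E_m^{**})\subseteq J_F(F)$; 3. $\widetilde A$ is separately weak\*-weak\* continuous, that is, for each $j$ and each choice of the other variables, $\widetilde A$ is continuous in the $j$-th variable from $(E_j^{**},\sigma(E_j^{**},E_j^*))$ to $(F^{**},\sigma(F^{**},F^*))$. Then $\widetilde A$ is separately almost Dunford-Pettis, and so is $A$. -/

import Mathlib

open Filter Topology

/-!
Throughout, a real Banach lattice is a type `E` with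
`[NormedAddCommGroup E] [NormedSpace ℝ E] [Lattice E] [HasSolidNorm E] [IsOrderedAddMonoid E]
[IsOrderedModule ℝ E] [CompleteSpace E]`.

The first part equips the norm dual `StrongDual ℝ E` with its usual order
(`f ≤ g` iff `f x ≤ g x` for all `x ≥ 0`) and proves that the dual, with the operator norm, is
again a Banach lattice, by means of the Riesz-Kantorovich formula for the positive part.
The same instances then apply to the bidual `StrongDual ℝ (StrongDual ℝ E)`.
-/

namespace BanachLattice

theorem norm_le_of_le {E : Type*} [NormedAddCommGroup E] [Lattice E] [HasSolidNorm E]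
    [IsOrderedAddMonoid E] {x y : E} (hx : 0 ≤ x) (h : x ≤ y) : ‖x‖ ≤ ‖y‖ :=
  norm_le_norm_of_abs_le_abs (by rwa [abs_of_nonneg hx, abs_of_nonneg (hx.trans h)])

section DualLattice

variable {E : Type*} [NormedAddCommGroup E] [NormedSpace ℝ E] [Lattice E] [HasSolidNorm E]
  [IsOrderedAddMonoid E] [IsOrderedModule ℝ E]

/-- The dual order: `f ≤ g` if and only if `f x ≤ g x` for every `x ≥ 0`. -/
instance instPartialOrderDual : PartialOrder (StrongDual ℝ E) where
  le f g := ∀ x : E, 0 ≤ x → f x ≤ g x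
  le_refl _ _ _ := le_rfl
  le_trans _ _ _ h₁ h₂ x hx := (h₁ x hx).trans (h₂ x hx)
  le_antisymm f g h₁ h₂ := by
    ext x
    have key : ∀ y : E, 0 ≤ y → f y = g y := fun y hy => le_antisymm (h₁ y hy) (h₂ y hy)
    rw [← posPart_sub_negPart x, map_sub, map_sub, key _ (posPart_nonneg x),
      key _ (negPart_nonneg x)]

theorem dual_le_iff {f g : StrongDual ℝ E} : f ≤ g ↔ ∀ x : E, 0 ≤ x → f x ≤ g x := Iff.rfl

/-- The value at `x ≥ 0` of the positive part of `f`: the supremum of `f y`, `0 ≤ y ≤ x`. -/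
noncomputable def posAux (f : StrongDual ℝ E) (x : E) : ℝ := sSup (f '' Set.Icc 0 x)

theorem apply_le_norm_mul (f : StrongDual ℝ E) {x y : E} (h : |y| ≤ |x|) :
    f y ≤ ‖f‖ * ‖x‖ :=
  (le_abs_self _).trans ((f.le_opNorm y).trans
    (mul_le_mul_of_nonneg_left (norm_le_norm_of_abs_le_abs h) (norm_nonneg f)))

theorem apply_le_of_mem_Icc (f : StrongDual ℝ E) {x y : E} (h : y ∈ Set.Icc 0 x) :
    f y ≤ ‖f‖ * ‖x‖ :=
  apply_le_norm_mul f (by rw [abs_of_nonneg h.1, abs_of_nonneg (h.1.trans h.2)]; exact h.2)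

theorem le_posAux (f : StrongDual ℝ E) {x y : E} (h0 : 0 ≤ y) (h : y ≤ x) :
    f y ≤ posAux f x :=
  le_csSup ⟨‖f‖ * ‖x‖, by rintro _ ⟨z, hz, rfl⟩; exact apply_le_of_mem_Icc f hz⟩
    ⟨y, ⟨h0, h⟩, rfl⟩

theorem posAux_le (f : StrongDual ℝ E) {x : E} (hx : 0 ≤ x) {c : ℝ}
    (h : ∀ y, 0 ≤ y → y ≤ x → f y ≤ c) : posAux f x ≤ c :=
  csSup_le ⟨f 0, 0, ⟨le_rfl, hx⟩, rfl⟩ (by rintro _ ⟨z, hz, rfl⟩; exact h z hz.1 hz.2)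

theorem posAux_nonneg (f : StrongDual ℝ E) {x : E} (hx : 0 ≤ x) : 0 ≤ posAux f x := by
  simpa using le_posAux f le_rfl hx

theorem posAux_le_norm (f : StrongDual ℝ E) {x : E} (hx : 0 ≤ x) :
    posAux f x ≤ ‖f‖ * ‖x‖ :=
  posAux_le f hx fun _ h0 h => apply_le_of_mem_Icc f ⟨h0, h⟩

theorem posAux_add (f : StrongDual ℝ E) {a b : E} (ha : 0 ≤ a) (hb : 0 ≤ b) :
    posAux f (a + b) = posAux f a + posAux f b := by
  apply le_antisymm
  · refine posAux_le f (add_nonneg ha hb) fun y hy hyab => ?_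
    have h1 : f (y ⊓ a) ≤ posAux f a := le_posAux f (le_inf hy ha) inf_le_right
    have h2 : f (y - y ⊓ a) ≤ posAux f b := by
      refine le_posAux f (sub_nonneg.2 inf_le_left) ?_
      rw [sub_le_iff_le_add]
      rw [add_inf]
      exact le_inf (le_add_of_nonneg_left hb) (by rwa [add_comm b a])
    have h3 : f y = f (y ⊓ a) + f (y - y ⊓ a) := by rw [← map_add]; congr 1; abel
    linarith
  · rw [← le_sub_iff_add_le]
    refine posAux_le f ha fun y hy hya => ?_
    rw [le_sub_iff_add_le, ← le_sub_iff_add_le']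
    refine posAux_le f hb fun z hz hzb => ?_
    have := le_posAux f (add_nonneg hy hz) (add_le_add hya hzb)
    rw [map_add] at this
    linarith

theorem posAux_sub_posAux (f : StrongDual ℝ E) {a b c d : E} (ha : 0 ≤ a) (hb : 0 ≤ b)
    (hc : 0 ≤ c) (hd : 0 ≤ d) (h : a - b = c - d) :
    posAux f a - posAux f b = posAux f c - posAux f d := by
  have h' : a + d = c + b := sub_eq_sub_iff_add_eq_add.1 h
  have := congrArg (posAux f) h'
  rw [posAux_add f ha hd, posAux_add f hc hb] at this
  linarith

/-- The positive part of a functional as an additive map. -/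
noncomputable def posHom (f : StrongDual ℝ E) : E →+ ℝ :=
  AddMonoidHom.mk' (fun x => posAux f x⁺ - posAux f x⁻) fun x y => by
    have h := posAux_sub_posAux f (posPart_nonneg (x + y)) (negPart_nonneg (x + y))
      (add_nonneg (posPart_nonneg x) (posPart_nonneg y))
      (add_nonneg (negPart_nonneg x) (negPart_nonneg y))
      (by rw [posPart_sub_negPart, add_sub_add_comm, posPart_sub_negPart, posPart_sub_negPart])
    rw [h, posAux_add f (posPart_nonneg x) (posPart_nonneg y),
      posAux_add f (negPart_nonneg x) (negPart_nonneg y)]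
    ring

theorem posHom_continuous (f : StrongDual ℝ E) : Continuous (posHom f) := by
  refine AddMonoidHomClass.continuous_of_bound (posHom f) ‖f‖ fun x => ?_
  have hp : ‖x⁺‖ ≤ ‖x‖ := by
    rw [← norm_abs_eq_norm x]
    exact norm_le_of_le (posPart_nonneg x) (sup_le (le_abs_self x) (abs_nonneg x))
  have hn : ‖x⁻‖ ≤ ‖x‖ := by
    rw [← norm_abs_eq_norm x]
    exact norm_le_of_le (negPart_nonneg x) (sup_le (neg_le_abs x) (abs_nonneg x))
  have h1 := posAux_le_norm f (posPart_nonneg x)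
  have h2 := posAux_le_norm f (negPart_nonneg x)
  have h3 := posAux_nonneg f (posPart_nonneg x)
  have h4 := posAux_nonneg f (negPart_nonneg x)
  have h5 := mul_le_mul_of_nonneg_left hp (norm_nonneg f)
  have h6 := mul_le_mul_of_nonneg_left hn (norm_nonneg f)
  change |posAux f x⁺ - posAux f x⁻| ≤ _
  rw [abs_le]
  constructor <;> linarith

/-- The positive part of a continuous functional. -/
noncomputable def dualPos (f : StrongDual ℝ E) : StrongDual ℝ E :=
  (posHom f).toRealLinearMap (posHom_continuous f)

/-- The Riesz-Kantorovich formula for the positive part. -/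
theorem dualPos_apply (f : StrongDual ℝ E) {x : E} (hx : 0 ≤ x) :
    dualPos f x = sSup (f '' Set.Icc 0 x) := by
  change posAux f x⁺ - posAux f x⁻ = posAux f x
  have h := posAux_sub_posAux f (posPart_nonneg x) (negPart_nonneg x) hx le_rfl
    (by rw [posPart_sub_negPart, sub_zero])
  have h0 := posAux_add f (le_refl (0 : E)) (le_refl (0 : E))
  rw [add_zero] at h0
  linarith

theorem le_dualPos (f : StrongDual ℝ E) : f ≤ dualPos f := fun x hx => by
  rw [dualPos_apply f hx]; exact le_posAux f hx le_rfl

theorem dualPos_nonneg (f : StrongDual ℝ E) {x : E} (hx : 0 ≤ x) : 0 ≤ dualPos f x := by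
  rw [dualPos_apply f hx]; exact posAux_nonneg f hx

theorem dualPos_le {f g : StrongDual ℝ E} (hfg : f ≤ g) (hg : ∀ x : E, 0 ≤ x → 0 ≤ g x) :
    dualPos f ≤ g := fun x hx => by
  rw [dualPos_apply f hx]
  refine posAux_le f hx fun y hy hyx => (hfg y hy).trans ?_
  have := hg (x - y) (sub_nonneg.2 hyx)
  rw [map_sub] at this
  linarith

/-- The dual of a Banach lattice is a lattice: `f ⊔ g = g + (f - g)⁺`, `f ⊓ g = f - (f - g)⁺`. -/
noncomputable instance instLatticeDual : Lattice (StrongDual ℝ E) where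
  __ := instPartialOrderDual
  sup f g := g + dualPos (f - g)
  inf f g := f - dualPos (f - g)
  le_sup_left f g x hx := by
    have := le_dualPos (f - g) x hx
    simp only [sub_apply, add_apply] at this ⊢
    linarith
  le_sup_right f g x hx := by
    have := dualPos_nonneg (f - g) hx
    simp only [add_apply]
    linarith
  sup_le f g h hf hg x hx := by
    have h1 : dualPos (f - g) ≤ h - g := by
      refine dualPos_le (fun y hy => ?_) fun y hy => ?_
      · have := hf y hy
        simp only [sub_apply]
        linarith
      · have := hg y hy
        simp only [sub_apply]
        linarith
    have := h1 x hx
    simp only [sub_apply, add_apply] at this ⊢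
    linarith
  inf_le_left f g x hx := by
    have := dualPos_nonneg (f - g) hx
    simp only [sub_apply]
    linarith
  inf_le_right f g x hx := by
    have := le_dualPos (f - g) x hx
    simp only [sub_apply] at this ⊢
    linarith
  le_inf h f g hf hg x hx := by
    have h1 : dualPos (f - g) ≤ f - h := by
      refine dualPos_le (fun y hy => ?_) fun y hy => ?_
      · have := hg y hy
        simp only [sub_apply]
        linarith
      · have := hf y hy
        simp only [sub_apply]
        linarith
    have := h1 x hx
    simp only [sub_apply] at this ⊢
    linarith

instance instIsOrderedAddMonoidDual : IsOrderedAddMonoid (StrongDual ℝ E) where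
  add_le_add_left f g h k x hx := by
    have := h x hx
    simp only [add_apply]
    linarith

instance instIsOrderedModuleDual : IsOrderedModule ℝ (StrongDual ℝ E) where
  smul_le_smul_of_nonneg_left a ha f g h x hx := by
    have := mul_le_mul_of_nonneg_left (h x hx) ha
    simpa using this
  smul_le_smul_of_nonneg_right f hf a b h x hx := by
    have h0 : 0 ≤ f x := by simpa using hf x hx
    have := mul_le_mul_of_nonneg_right h h0
    simpa using this

theorem abs_apply_le (f : StrongDual ℝ E) (x : E) : |f x| ≤ |f| |x| := by
  have h1 : ∀ y : E, 0 ≤ y → f y ≤ |f| y := dual_le_iff.1 (le_abs_self f)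
  have h2 : ∀ y : E, 0 ≤ y → -f y ≤ |f| y := fun y hy => dual_le_iff.1 (neg_le_abs f) y hy
  have hx : f x = f x⁺ - f x⁻ := by rw [← map_sub, posPart_sub_negPart]
  have ha : |f| |x| = |f| x⁺ + |f| x⁻ := by rw [← map_add, posPart_add_negPart]
  have p1 := h1 _ (posPart_nonneg x)
  have p2 := h2 _ (posPart_nonneg x)
  have n1 := h1 _ (negPart_nonneg x)
  have n2 := h2 _ (negPart_nonneg x)
  rw [hx, ha, abs_le]
  constructor <;> linarith

theorem abs_dual_apply_le (f : StrongDual ℝ E) {x : E} (hx : 0 ≤ x) : |f| x ≤ ‖f‖ * ‖x‖ := by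
  change (-f + dualPos (f - -f)) x ≤ _
  rw [add_apply, dualPos_apply _ hx, neg_apply,
    ← le_sub_iff_add_le']
  refine posAux_le _ hx fun y hy hyx => ?_
  have h : |y + y - x| ≤ |x| := by
    rw [abs_of_nonneg hx, abs_le']
    constructor
    · rw [sub_le_iff_le_add]
      exact add_le_add hyx hyx
    · rw [neg_sub]
      exact sub_le_self _ (add_nonneg hy hy)
  have := apply_le_norm_mul f h
  simp only [map_sub, map_add] at this
  simp only [sub_apply, neg_apply]
  linarith

instance instHasSolidNormDual : HasSolidNorm (StrongDual ℝ E) where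
  solid f g h := by
    refine ContinuousLinearMap.opNorm_le_bound f (norm_nonneg g) fun x => ?_
    calc ‖f x‖ = |f x| := Real.norm_eq_abs _
      _ ≤ |f| |x| := abs_apply_le f x
      _ ≤ |g| |x| := h _ (abs_nonneg x)
      _ ≤ ‖g‖ * ‖|x|‖ := abs_dual_apply_le g (abs_nonneg x)
      _ = ‖g‖ * ‖x‖ := by rw [norm_abs_eq_norm]

end DualLattice

/-- A sequence in a normed space is weakly null. -/
def WeaklyNull {E : Type*} [NormedAddCommGroup E] [NormedSpace ℝ E] (x : ℕ → E) : Prop :=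
  ∀ φ : StrongDual ℝ E, Tendsto (fun n => φ (x n)) atTop (𝓝 0)

/-- A sequence is disjoint if its terms are pairwise disjoint (`|x n| ⊓ |x k| = 0`). -/
def DisjointSeq {E : Type*} [AddCommGroup E] [Lattice E] (x : ℕ → E) : Prop :=
  ∀ n k : ℕ, n ≠ k → |x n| ⊓ |x k| = 0

/-- The positive Schur property: positive weakly null sequences are norm null. -/
def PositiveSchurProperty (E : Type*) [NormedAddCommGroup E] [NormedSpace ℝ E] [Lattice E] :
    Prop :=
  ∀ x : ℕ → E, (∀ n, 0 ≤ x n) → WeaklyNull x → Tendsto (fun n => ‖x n‖) atTop (𝓝 0)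

/-- The norm is order continuous: a nonempty downward directed set with infimum `0`, regarded
as a decreasing net, converges to `0` in norm. -/
def OrderContinuousNorm (F : Type*) [NormedAddCommGroup F] [Lattice F] : Prop :=
  ∀ S : Set F, S.Nonempty → DirectedOn (· ≥ ·) S → IsGLB S 0 →
    ∀ ε : ℝ, 0 < ε → ∃ a ∈ S, ∀ b ∈ S, b ≤ a → ‖b‖ < ε

/-- A linear operator from a Banach lattice to a Banach space is almost Dunford-Pettis if it
sends disjoint weakly null sequences to norm null sequences. -/
def AlmostDunfordPettis {E G : Type*} [NormedAddCommGroup E] [NormedSpace ℝ E] [Lattice E]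
    [NormedAddCommGroup G] [NormedSpace ℝ G] (u : E →ₗ[ℝ] G) : Prop :=
  ∀ x : ℕ → E, DisjointSeq x → WeaklyNull x → Tendsto (fun n => ‖u (x n)‖) atTop (𝓝 0)

section Multilinear

variable {ι : Type*} {E : ι → Type*} {F : Type*}
  [∀ i, NormedAddCommGroup (E i)] [∀ i, NormedSpace ℝ (E i)]
  [NormedAddCommGroup F] [NormedSpace ℝ F]

/-- Separately almost Dunford-Pettis: each linear operator obtained by fixing all the variables
but one is almost Dunford-Pettis. -/
def SeparatelyAlmostDunfordPettis [DecidableEq ι] [∀ i, Lattice (E i)]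
    (A : MultilinearMap ℝ E F) : Prop :=
  ∀ (j : ι) (x : ∀ i, E i), AlmostDunfordPettis (A.toLinearMap x j)

/-- A multilinear operator between ordered spaces is positive if it is nonnegative on tuples of
nonnegative vectors. -/
def PositiveMultilinear [∀ i, Lattice (E i)] [Lattice F] (A : MultilinearMap ℝ E F) : Prop :=
  ∀ x : ∀ i, E i, (∀ i, 0 ≤ x i) → 0 ≤ A x

/-- The continuous multilinear operator `B` between the biduals extends `A`:
`B (J x₁, …, J xₘ) = J (A (x₁, …, xₘ))`. -/
def IsBidualExtension (A : MultilinearMap ℝ E F)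
    (B : ContinuousMultilinearMap ℝ (fun i => StrongDual ℝ (StrongDual ℝ (E i)))
      (StrongDual ℝ (StrongDual ℝ F))) : Prop :=
  ∀ x : ∀ i, E i, B (fun i => NormedSpace.inclusionInDoubleDual ℝ (E i) (x i)) =
    NormedSpace.inclusionInDoubleDual ℝ F (A x)

/-- `B` is genuine: it takes its values in the canonical copy of `F` in its bidual. -/
def IsGenuine (B : ContinuousMultilinearMap ℝ (fun i => StrongDual ℝ (StrongDual ℝ (E i)))
    (StrongDual ℝ (StrongDual ℝ F))) : Prop :=
  ∀ z, B z ∈ Set.range (NormedSpace.inclusionInDoubleDual ℝ F)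

/-- `B` is separately weak*-weak* continuous: in each variable, the others being fixed, it is
continuous for the topologies `σ(E_j**, E_j*)` and `σ(F**, F*)`. -/
def SeparatelyWeakStarContinuous [DecidableEq ι]
    (B : ContinuousMultilinearMap ℝ (fun i => StrongDual ℝ (StrongDual ℝ (E i)))
      (StrongDual ℝ (StrongDual ℝ F))) : Prop :=
  ∀ (j : ι) (z : ∀ i, StrongDual ℝ (StrongDual ℝ (E i))),
    Continuous fun t : WeakDual ℝ (StrongDual ℝ (E j)) =>
      StrongDual.toWeakDual (B (Function.update z j (WeakDual.toStrongDual t)))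

end Multilinear

end BanachLattice

/-! Fix all variables but the `j`-th at positive vectors of the biduals. This gives a positive
operator `u : E** → F**` with values in `F`. Being weak*-weak* continuous, it is the adjoint of a
positive operator `T : F* → E*` (`preadjoint`, `apply_preadjoint`).

Let `f n` be positive disjoint functionals in the unit ball of `F*`. Order continuity of the norm
makes them weak* null (`OrderContinuousNorm.tendsto_apply_of_disjoint`). For `t` in `E**`, `t (T (f
n))` is the value of `f n` at the vector of `F` representing `u t`, so `T (f n)` is weakly null. The
positive Schur property of `E*` then yields `‖T (f n)‖ → 0`.

A disjointification argument (`exists_norm_apply_posPart_sub_lt`) upgrades this to a uniform bound: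
for some `w ≥ 0`, `‖T (f - w)⁺‖` is small for every positive `f` in the ball. Hence, for `x n ≥ 0`
weakly null, `‖u (x n)‖` is at most `x n (T w)`, which tends to `0`, plus a small multiple of `sup
‖x n‖`.

General disjoint sequences and fixed variables reduce to positive ones: `|x n|` is again weakly null
(`WeaklyNull.abs_of_disjoint`), and `|B z| ≤ B |z|`. The claim for `A` follows by restriction, the
canonical embeddings being isometric and positive. -/

namespace BanachLattice

/-! ### Disjointness in ordered groups and vector lattices. -/

section LatticeGroup

variable {G : Type*} [AddCommGroup G] [Lattice G] [IsOrderedAddMonoid G]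

theorem inf_add_le_inf_add_inf {a b c : G} (ha : 0 ≤ a) (hb : 0 ≤ b) (hc : 0 ≤ c) :
    a ⊓ (b + c) ≤ a ⊓ b + a ⊓ c := by
  rw [inf_add, add_inf, add_inf]
  refine le_inf (le_inf ?_ ?_) (le_inf ?_ inf_le_right)
  · exact inf_le_left.trans (le_add_of_nonneg_right ha)
  · exact inf_le_left.trans (le_add_of_nonneg_right hc)
  · exact inf_le_left.trans (le_add_of_nonneg_left hb)

theorem inf_add_eq_zero {a b c : G} (ha : 0 ≤ a) (hb : 0 ≤ b) (hc : 0 ≤ c) (hab : a ⊓ b = 0)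
    (hac : a ⊓ c = 0) : a ⊓ (b + c) = 0 :=
  le_antisymm ((inf_add_le_inf_add_inf ha hb hc).trans (by rw [hab, hac, add_zero]))
    (le_inf ha (add_nonneg hb hc))

theorem inf_eq_zero_mono {a a' b b' : G} (ha : 0 ≤ a) (hb : 0 ≤ b) (haa : a ≤ a') (hbb : b ≤ b')
    (h : a' ⊓ b' = 0) : a ⊓ b = 0 :=
  le_antisymm ((inf_le_inf haa hbb).trans h.le) (le_inf ha hb)

theorem inf_sum_eq_zero {κ : Type*} {a : G} (ha : 0 ≤ a) {f : κ → G} (hf : ∀ i, 0 ≤ f i)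
    (s : Finset κ) (h : ∀ i ∈ s, a ⊓ f i = 0) : a ⊓ ∑ i ∈ s, f i = 0 := by
  classical
  induction s using Finset.induction_on with
  | empty => simpa using ha
  | insert i s hi ih =>
    rw [Finset.sum_insert hi]
    exact inf_add_eq_zero ha (hf i) (Finset.sum_nonneg fun i _ => hf i)
      (h i (Finset.mem_insert_self i s)) (ih fun k hk => h k (Finset.mem_insert_of_mem hk))

/-- Disjointness gives `|a| + |b| = ||a| - |b||`, which never exceeds `|a + b|`. -/
theorem abs_add_of_disjoint {a b : G} (h : |a| ⊓ |b| = 0) : |a + b| = |a| + |b| := by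
  refine le_antisymm (abs_add_le a b) ?_
  have h1 := two_nsmul_inf_eq_add_sub_abs_sub |a| |b|
  rw [h, smul_zero, eq_comm, sub_eq_zero] at h1
  rw [h1]
  have h2 := abs_abs_sub_abs_le b (-a)
  rwa [abs_neg, sub_neg_eq_add, add_comm b a] at h2

theorem abs_posPart_sub_posPart_sub_le {p q : G} (hq : 0 ≤ q) : |p⁺ - (p - q)⁺| ≤ q := by
  rw [abs_of_nonneg (sub_nonneg.2 (posPart_mono (sub_le_self p hq))), sub_le_iff_le_add]
  refine sup_le ?_ (add_nonneg hq (posPart_nonneg _))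
  rw [← sub_le_iff_le_add']
  exact le_posPart _

variable [Module ℝ G] [IsOrderedModule ℝ G]

/-- Some natural number dominates `c`, so `c • b` lies below a finite sum of copies of `b`. -/
theorem inf_smul_eq_zero {a b : G} (ha : 0 ≤ a) (hb : 0 ≤ b) {c : ℝ} (hc : 0 ≤ c)
    (h : a ⊓ b = 0) : a ⊓ c • b = 0 := by
  obtain ⟨n, hn⟩ := exists_nat_ge c
  have h1 : a ⊓ ∑ _i ∈ Finset.range n, b = 0 := inf_sum_eq_zero ha (fun _ => hb) _ fun _ _ => h
  refine inf_eq_zero_mono ha (smul_nonneg hc hb) le_rfl ?_ h1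
  rw [Finset.sum_const, Finset.card_range, ← Nat.cast_smul_eq_nsmul ℝ]
  exact smul_le_smul_of_nonneg_right hn hb

theorem abs_smul_eq (c : ℝ) (x : G) : |c • x| = |c| • |x| := by
  have hle : ∀ (c : ℝ) (x : G), |c • x| ≤ |c| • |x| := fun c x => by
    wlog hc : 0 ≤ c generalizing c
    · simpa using this (-c) (neg_nonneg.2 (le_of_not_ge hc))
    rw [abs_of_nonneg hc]
    refine sup_le (smul_le_smul_of_nonneg_left (le_abs_self x) hc) ?_
    rw [← smul_neg]
    exact smul_le_smul_of_nonneg_left (neg_le_abs x) hc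
  refine le_antisymm (hle c x) ?_
  obtain rfl | hc := eq_or_ne c 0
  · simp
  -- The reverse inequality is the first one applied to `c⁻¹` and `c • x`.
  have := smul_le_smul_of_nonneg_left (hle c⁻¹ (c • x)) (abs_nonneg c)
  rwa [inv_smul_smul₀ hc, abs_inv, smul_inv_smul₀ (abs_ne_zero.2 hc)] at this

theorem abs_sum_smul_of_disjoint {x : ℕ → G} (hx : DisjointSeq x) (c : ℕ → ℝ) (s : Finset ℕ) :
    |∑ i ∈ s, c i • x i| = ∑ i ∈ s, |c i| • |x i| := by
  induction s using Finset.induction_on with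
  | empty => simp
  | insert k s hk ih =>
    rw [Finset.sum_insert hk, Finset.sum_insert hk, abs_add_of_disjoint, ih, abs_smul_eq]
    rw [ih, abs_smul_eq]
    refine inf_sum_eq_zero (smul_nonneg (abs_nonneg _) (abs_nonneg _))
      (fun i => smul_nonneg (abs_nonneg (c i)) (abs_nonneg (x i))) s fun i hi => ?_
    refine inf_smul_eq_zero (smul_nonneg (abs_nonneg _) (abs_nonneg _)) (abs_nonneg _)
      (abs_nonneg _) ?_
    rw [inf_comm]
    refine inf_smul_eq_zero (abs_nonneg _) (abs_nonneg _) (abs_nonneg _) (hx i k ?_)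
    rintro rfl
    exact hk hi

/-- The vectors `(a - p⁻¹ b)⁺` and `(b - p a)⁺` are disjoint. -/
theorem posPart_sub_smul_inf_eq_zero (a b : G) {p : ℝ} (hp : 0 < p) :
    (a - p⁻¹ • b)⁺ ⊓ (b - p • a)⁺ = 0 := by
  have h : (b - p • a)⁺ ≤ p • (a - p⁻¹ • b)⁻ := by
    refine sup_le ?_ (smul_nonneg hp.le (negPart_nonneg _))
    have := smul_le_smul_of_nonneg_left (neg_le_negPart (a - p⁻¹ • b)) hp.le
    rwa [neg_sub, smul_sub, smul_inv_smul₀ hp.ne'] at this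
  exact inf_eq_zero_mono (posPart_nonneg _) (posPart_nonneg _) le_rfl h
    (inf_smul_eq_zero (posPart_nonneg _) (negPart_nonneg _) hp.le (posPart_inf_negPart_eq_zero _))

end LatticeGroup

section PositiveFunctional

variable {F : Type*} [NormedAddCommGroup F] [NormedSpace ℝ F] [Lattice F] [HasSolidNorm F]
  [IsOrderedAddMonoid F] [IsOrderedModule ℝ F]

theorem monotone_apply {f : StrongDual ℝ F} (hf : 0 ≤ f) {x y : F} (h : x ≤ y) : f x ≤ f y := by
  have := hf (y - x) (sub_nonneg.2 h)
  simpa using this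

theorem apply_nonneg {f : StrongDual ℝ F} (hf : 0 ≤ f) {x : F} (h : 0 ≤ x) : 0 ≤ f x := by
  simpa using monotone_apply hf h

end PositiveFunctional

/-! ### Order continuous norms and disjoint functionals. -/

section OrderContinuous

variable {F : Type*} [NormedAddCommGroup F] [NormedSpace ℝ F] [Lattice F] [HasSolidNorm F]
  [IsOrderedAddMonoid F] [IsOrderedModule ℝ F]

/-- For an order continuous norm, increasing order bounded sequences are Cauchy. -/
theorem OrderContinuousNorm.cauchySeq_of_monotone (hF : OrderContinuousNorm F) {a : ℕ → F}
    (ha : Monotone a) {x : F} (hx : ∀ n, a n ≤ x) : CauchySeq a := by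
  -- All upper bounds `u` are used, since a supremum of `a` is not yet known to exist.
  let S : Set F := {z | ∃ u n, (∀ k, a k ≤ u) ∧ z = u - a n}
  have hdir : DirectedOn (· ≥ ·) S := by
    rintro _ ⟨u, n, hu, rfl⟩ _ ⟨v, k, hv, rfl⟩
    refine ⟨u ⊓ v - a (max n k), ⟨_, _, fun i => le_inf (hu i) (hv i), rfl⟩, ?_, ?_⟩
    · exact sub_le_sub inf_le_left (ha (le_max_left _ _))
    · exact sub_le_sub inf_le_right (ha (le_max_right _ _))
  have hglb : IsGLB S 0 := by
    refine ⟨?_, fun c hc => ?_⟩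
    · rintro _ ⟨u, n, hu, rfl⟩
      exact sub_nonneg.2 (hu n)
    -- Subtracting `c⁺` from an upper bound leaves an upper bound. Iterating gives `n • c⁺ ≤ x - a
    -- 0` for all `n`, which forces `c⁺ = 0`.
    have hc' : ∀ u, (∀ k, a k ≤ u) → ∀ k, a k ≤ u - c⁺ := fun u hu k => by
      rw [le_sub_comm]
      exact sup_le (hc ⟨u, k, hu, rfl⟩) (sub_nonneg.2 (hu k))
    have hn : ∀ n : ℕ, ∀ k, a k ≤ x - n • c⁺ := fun n => by
      induction n with
      | zero => simpa using hx
      | succ n ih =>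
        have := hc' _ ih
        simpa only [succ_nsmul, sub_add_eq_sub_sub] using this
    have hnorm : ∀ n : ℕ, n * ‖c⁺‖ ≤ ‖x - a 0‖ := fun n => by
      have := norm_le_of_le (nsmul_nonneg (posPart_nonneg c) n) (le_sub_comm.1 (hn n 0))
      rwa [← Nat.cast_smul_eq_nsmul ℝ, norm_smul, Real.norm_natCast] at this
    have h0 : ‖c⁺‖ = 0 := by
      by_contra h
      have hpos : 0 < ‖c⁺‖ := lt_of_le_of_ne (norm_nonneg _) (Ne.symm h)
      obtain ⟨n, hn⟩ := exists_nat_gt (‖x - a 0‖ / ‖c⁺‖)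
      rw [div_lt_iff₀ hpos] at hn
      exact (hnorm n).not_gt hn
    exact (le_posPart c).trans (norm_eq_zero.1 h0).le
  rw [Metric.cauchySeq_iff']
  intro ε hε
  obtain ⟨_, ⟨u, n, hu, rfl⟩, h⟩ := hF S ⟨x - a 0, x, 0, hx, rfl⟩ hdir hglb ε hε
  refine ⟨n, fun k hk => ?_⟩
  rw [dist_eq_norm]
  refine (norm_le_of_le (sub_nonneg.2 (ha hk)) ?_).trans_lt
    (h (u - a n) ⟨u, n, hu, rfl⟩ le_rfl)
  exact sub_le_sub_right (hu k) _

variable [CompleteSpace F]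

theorem OrderContinuousNorm.exists_tendsto_of_monotone (hF : OrderContinuousNorm F) {a : ℕ → F}
    (ha : Monotone a) {x : F} (hx : ∀ n, a n ≤ x) :
    ∃ s, Tendsto a atTop (𝓝 s) ∧ IsLUB (Set.range a) s := by
  obtain ⟨s, hs⟩ := cauchySeq_tendsto_of_complete (hF.cauchySeq_of_monotone ha hx)
  exact ⟨s, hs, isLUB_of_tendsto_atTop ha hs⟩

theorem OrderContinuousNorm.exists_tendsto_of_antitone (hF : OrderContinuousNorm F) {a : ℕ → F}
    (ha : Antitone a) {x : F} (hx : ∀ n, x ≤ a n) :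
    ∃ s, Tendsto a atTop (𝓝 s) ∧ IsGLB (Set.range a) s := by
  obtain ⟨s, hs, -⟩ := hF.exists_tendsto_of_monotone (a := fun n => -a n) (x := -x)
    (fun i j h => neg_le_neg (ha h)) (fun n => neg_le_neg (hx n))
  have hs' : Tendsto a atTop (𝓝 (-s)) := by simpa using hs.neg
  exact ⟨-s, hs', isGLB_of_tendsto_atTop ha hs'⟩

/-- On an order interval of a Banach lattice with order continuous norm, a bounded sequence of
positive functionals which are absolutely continuous with respect to a positive functional `f` is
uniformly absolutely continuous with respect to `f`. -/
theorem OrderContinuousNorm.uniform_absolutelyContinuous (hF : OrderContinuousNorm F)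
    {f : StrongDual ℝ F} (hf : 0 ≤ f) {g : ℕ → StrongDual ℝ F} (hg : ∀ n, 0 ≤ g n)
    (hg1 : ∀ n, ‖g n‖ ≤ 1) (hfg : ∀ n z, 0 ≤ z → f z = 0 → g n z = 0) (x : F)
    {ε : ℝ} (hε : 0 < ε) :
    ∃ δ > 0, ∀ z, 0 ≤ z → z ≤ x → f z < δ → ∀ n, g n z ≤ ε := by
  -- Borel-Cantelli: the bounds `2⁻ⁿ` are summable, so the tail suprema `s i` of the bad vectors
  -- decrease to some `t` with `f t = 0`.
  by_contra! hcon
  choose z hz0 hzx hzf k hk using fun n : ℕ => hcon ((1 / 2 : ℝ) ^ n) (by positivity)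
  have hbound : ∀ i l : ℕ, partialSups (fun j => z (j + i)) l ≤ x := fun i l =>
    partialSups_le _ _ _ fun j _ => hzx _
  choose s hs hlub using fun i : ℕ =>
    hF.exists_tendsto_of_monotone (partialSups (fun j => z (j + i))).monotone (hbound i)
  have hzs : ∀ i j, z (j + i) ≤ s i := fun i j =>
    (le_partialSups (fun j => z (j + i)) j).trans ((hlub i).1 ⟨j, rfl⟩)
  have hs0 : ∀ i, 0 ≤ s i := fun i => (hz0 _).trans (hzs i 0)
  have hanti : Antitone s := by
    refine antitone_nat_of_succ_le fun i => (hlub (i + 1)).2 ?_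
    rintro _ ⟨l, rfl⟩
    refine partialSups_le _ _ _ fun j _ => ?_
    have := hzs i (j + 1)
    rwa [add_assoc, add_comm 1 i] at this
  have hfps : ∀ i l : ℕ, f (partialSups (fun j => z (j + i)) l) ≤
      (2 - (1 / 2 : ℝ) ^ l) * (1 / 2) ^ i := fun i l => by
    induction l with
    | zero =>
      rw [partialSups_zero]
      have := (hzf (0 + i)).le
      simp only [zero_add, pow_zero] at this ⊢
      linarith
    | succ l ih =>
      have h1 : 0 ≤ partialSups (fun j => z (j + i)) l :=
        (hz0 _).trans (le_partialSups_of_le (fun j => z (j + i)) (Nat.zero_le l))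
      have h2 : partialSups (fun j => z (j + i)) (l + 1) ≤
          partialSups (fun j => z (j + i)) l + z (l + 1 + i) := by
        rw [← Order.succ_eq_add_one, partialSups_succ]
        exact sup_le (le_add_of_nonneg_right (hz0 _)) (le_add_of_nonneg_left h1)
      have h3 := monotone_apply hf h2
      have h4 := (hzf (l + 1 + i)).le
      rw [f.map_add] at h3
      rw [pow_add, pow_succ] at h4
      rw [pow_succ]
      linarith
  have hfs : ∀ i, f (s i) ≤ 2 * (1 / 2 : ℝ) ^ i := fun i => by
    refine le_of_tendsto ((f.continuous.tendsto _).comp (hs i)) (Eventually.of_forall fun l => ?_)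
    refine (hfps i l).trans ?_
    gcongr
    have : (0 : ℝ) ≤ (1 / 2) ^ l := by positivity
    linarith
  obtain ⟨t, ht, htlb⟩ := hF.exists_tendsto_of_antitone hanti hs0
  have ht0 : 0 ≤ t := htlb.2 (by rintro _ ⟨i, rfl⟩; exact hs0 i)
  have hft : f t = 0 := by
    refine le_antisymm ?_ (apply_nonneg hf ht0)
    refine le_of_tendsto_of_tendsto ((f.continuous.tendsto _).comp ht) ?_
      (Eventually.of_forall hfs)
    simpa using (tendsto_pow_atTop_nhds_zero_of_lt_one (r := (1 / 2 : ℝ)) (by norm_num)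
      (by norm_num)).const_mul 2
  have hlim : Tendsto (fun i => ‖s i - t‖) atTop (𝓝 0) := by
    simpa using (ht.sub_const t).norm
  obtain ⟨i, hi⟩ := (hlim.eventually_lt_const hε).exists
  -- Absolute continuity kills `t` under every `g`; the varying index `k i` is harmless because the
  -- norms are bounded by `1`.
  have h1 : g (k i) (z i) ≤ g (k i) (s i - t) := by
    rw [map_sub, hfg (k i) t ht0 hft, sub_zero]
    refine monotone_apply (hg _) ?_
    simpa using hzs i 0
  have h2 : g (k i) (s i - t) ≤ ‖s i - t‖ :=
    (le_abs_self _).trans (((g (k i)).le_of_opNorm_le (hg1 _) _).trans (one_mul _).le)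
  linarith [hk i]

/-- The Riesz-Kantorovich description of disjointness of positive functionals. -/
theorem exists_apply_lt_of_inf_eq_zero {f g : StrongDual ℝ F} (hf : 0 ≤ f) (hg : 0 ≤ g)
    (h : f ⊓ g = 0) {x : F} (hx : 0 ≤ x) {η : ℝ} (hη : 0 < η) :
    ∃ y, 0 ≤ y ∧ y ≤ x ∧ g y < η ∧ f (x - y) < η := by
  have h1 : f - dualPos (f - g) = 0 := h
  -- Disjointness means `f = (f - g)⁺`; a near-maximiser `y` of `f - g` on `[0, x]` does the job.
  have h2 : f x = sSup ((f - g) '' Set.Icc 0 x) := by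
    rw [← dualPos_apply _ hx, ← sub_eq_zero, ← sub_apply, h1, zero_apply]
  obtain ⟨_, ⟨y, ⟨hy0, hyx⟩, rfl⟩, hy⟩ := exists_lt_of_lt_csSup
    (s := (f - g) '' Set.Icc 0 x) ⟨_, 0, ⟨le_rfl, hx⟩, rfl⟩ (h2 ▸ sub_lt_self (f x) hη)
  have h3 := apply_nonneg hg hy0
  have h4 := apply_nonneg hf (sub_nonneg.2 hyx)
  rw [sub_apply] at hy
  rw [map_sub] at h4
  refine ⟨y, hy0, hyx, ?_, ?_⟩
  · linarith
  · rw [map_sub]; linarith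

/-- Disjoint bounded sequences of positive functionals on a Banach lattice with order continuous
norm are weak* null. -/
theorem OrderContinuousNorm.tendsto_apply_of_disjoint (hF : OrderContinuousNorm F)
    {f : ℕ → StrongDual ℝ F} (hf : ∀ n, 0 ≤ f n) (hf1 : ∀ n, ‖f n‖ ≤ 1)
    (hdisj : ∀ n k, n ≠ k → f n ⊓ f k = 0) (x : F) :
    Tendsto (fun n => f n x) atTop (𝓝 0) := by
  wlog hx : 0 ≤ x generalizing x
  · have := (this x⁺ (posPart_nonneg x)).sub (this x⁻ (negPart_nonneg x))
    simpa only [← map_sub, posPart_sub_negPart, sub_zero] using this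
  -- The weights make the series converge; its sum `h` controls every `f n`.
  set g : ℕ → StrongDual ℝ F := fun n => (1 / 2 : ℝ) ^ n • f n with hgdef
  have hg0 : ∀ n, 0 ≤ g n := fun n => smul_nonneg (by positivity) (hf n)
  have hgsum : Summable g := by
    refine Summable.of_norm_bounded summable_geometric_two fun n => ?_
    rw [hgdef, norm_smul, norm_pow, Real.norm_of_nonneg (by norm_num)]
    exact mul_le_of_le_one_right (by positivity) (hf1 n)
  obtain ⟨h, hh⟩ := hgsum
  have hgh : ∀ n, g n ≤ h := fun n => le_hasSum hh n fun k _ => hg0 k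
  have hgg : ∀ n k, n ≠ k → g n ⊓ g k = 0 := fun n k hnk => by
    refine inf_smul_eq_zero (hg0 n) (hf k) (by positivity) ?_
    rw [inf_comm]
    exact inf_smul_eq_zero (hf k) (hf n) (by positivity) (hdisj k n hnk.symm)
  -- Replacing the `n`-th term by `0` gives a series for `h - g n`. Its partial sums are disjoint
  -- from `g n`, and `⊓` is continuous.
  have hrest : ∀ n, g n ⊓ (h - g n) = 0 := fun n => by
    have h1 := hh.update n 0
    rw [zero_sub, neg_add_eq_sub] at h1
    have h2 := (tendsto_const_nhds (x := g n)).inf_nhds h1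
    refine tendsto_nhds_unique h2 (tendsto_const_nhds.congr fun s => (inf_sum_eq_zero (hg0 n)
      (fun k => ?_) s fun k _ => ?_).symm)
    · obtain rfl | hk := eq_or_ne k n
      · simp
      · simpa [hk] using hg0 k
    · obtain rfl | hk := eq_or_ne k n
      · simpa using hg0 k
      · simpa [hk] using hgg n k hk.symm
  have hh0 : 0 ≤ h := (hg0 0).trans (hgh 0)
  have hfh : ∀ n z, 0 ≤ z → h z = 0 → f n z = 0 := fun n z hz hhz => by
    have h1 := hgh n z hz
    have h2 := apply_nonneg (hf n) hz
    rw [hhz] at h1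
    simp only [hgdef, smul_apply, smul_eq_mul] at h1
    exact le_antisymm (nonpos_of_mul_nonpos_right h1 (by positivity)) h2
  rw [Metric.tendsto_atTop']
  intro ε hε
  obtain ⟨δ, hδ, hδ'⟩ := hF.uniform_absolutelyContinuous hh0 hf hf1 hfh x (ε := ε / 4)
    (by positivity)
  have hsmall : Tendsto (fun n : ℕ => (1 / 2 : ℝ) ^ n * ‖x‖) atTop (𝓝 0) := by
    simpa using (tendsto_pow_atTop_nhds_zero_of_lt_one (r := (1 / 2 : ℝ)) (by norm_num)
      (by norm_num)).mul_const ‖x‖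
  obtain ⟨N, hN⟩ := eventually_atTop.1 (hsmall.eventually_lt_const (half_pos hδ))
  refine ⟨N, fun n hn => ?_⟩
  have hpow : (0 : ℝ) < (1 / 2) ^ n := by positivity
  -- The tolerance contains the weight `2⁻ⁿ`, so that `f n (x - y) < ε / 4` survives division by it.
  -- On `y`, `h` is below `δ` and uniform absolute continuity applies.
  obtain ⟨y, hy0, hyx, hy1, hy2⟩ := exists_apply_lt_of_inf_eq_zero (hg0 n)
    (sub_nonneg.2 (hgh n)) (hrest n) hx
    (lt_min (half_pos hδ) (mul_pos hpow (by positivity : 0 < ε / 4)))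
  have hgy : g n y ≤ (1 / 2 : ℝ) ^ n * ‖x‖ := by
    simp only [hgdef, smul_apply, smul_eq_mul]
    refine mul_le_mul_of_nonneg_left ?_ hpow.le
    refine (le_abs_self _).trans (((f n).le_of_opNorm_le (hf1 n) y).trans ?_)
    rw [one_mul]
    exact norm_le_of_le hy0 hyx
  have h1 : h y < δ := by
    have := lt_min_iff.1 hy1
    have := hN n hn.le
    rw [sub_apply] at *
    linarith
  have h2 := hδ' y hy0 hyx h1 n
  have h3 : f n (x - y) < ε / 4 := by
    have := (lt_min_iff.1 hy2).2
    simp only [hgdef, smul_apply, smul_eq_mul] at this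
    exact lt_of_mul_lt_mul_left this hpow.le
  rw [map_sub] at h3
  rw [Real.dist_eq, sub_zero, abs_of_nonneg (apply_nonneg (hf n) hx)]
  linarith

end OrderContinuous

/-! ### Disjointification of sequences in the unit ball. -/

section Disjointification

variable {G H : Type*} [NormedAddCommGroup G] [NormedSpace ℝ G] [Lattice G] [HasSolidNorm G]
  [IsOrderedAddMonoid G] [IsOrderedModule ℝ G] [CompleteSpace G]
  [NormedAddCommGroup H] [NormedSpace ℝ H]

/-- If a continuous operator sends disjoint sequences of positive elements of the unit ball to norm
null sequences, then it is uniformly small on the positive part of the unit ball, up to an order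
interval. -/
theorem exists_norm_apply_posPart_sub_lt (T : G →L[ℝ] H)
    (hT : ∀ v : ℕ → G, (∀ n, 0 ≤ v n) → (∀ n, ‖v n‖ ≤ 1) → (∀ n k, n ≠ k → v n ⊓ v k = 0) →
      Tendsto (fun n => ‖T (v n)‖) atTop (𝓝 0)) {ε : ℝ} (hε : 0 < ε) :
    ∃ u : G, 0 ≤ u ∧ ∀ f : G, 0 ≤ f → ‖f‖ ≤ 1 → ‖T (f - u)⁺‖ < ε := by
  by_contra! hcon
  choose! f hf0 hf1 hfε using hcon
  -- `x n` is the counterexample for `u = 4ⁿ • S n`, where `S n` is the sum of the earlier `x k`.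
  let S : ℕ → G := fun n => Nat.rec 0 (fun n s => s + f ((4 : ℝ) ^ n • s)) n
  let x : ℕ → G := fun n => f ((4 : ℝ) ^ n • S n)
  have hSs : ∀ n, S (n + 1) = S n + x n := fun n => rfl
  have hS0 : ∀ n, 0 ≤ S n := fun n => by
    induction n with
    | zero => exact le_rfl
    | succ n ih => exact add_nonneg ih (hf0 _ (smul_nonneg (by positivity) ih))
  have hS4 : ∀ n, 0 ≤ (4 : ℝ) ^ n • S n := fun n => smul_nonneg (by positivity) (hS0 n)
  have hx0 : ∀ n, 0 ≤ x n := fun n => hf0 _ (hS4 n)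
  have hx1 : ∀ n, ‖x n‖ ≤ 1 := fun n => hf1 _ (hS4 n)
  have hxε : ∀ n, ε ≤ ‖T (x n - (4 : ℝ) ^ n • S n)⁺‖ := fun n => hfε _ (hS4 n)
  have hSmono : Monotone S := monotone_nat_of_le_succ fun n => by
    rw [hSs]
    exact le_add_of_nonneg_right (hx0 n)
  have hxS : ∀ n m, n < m → x n ≤ S m := fun n m h =>
    (le_add_of_nonneg_left (hS0 n)).trans ((hSs n).ge.trans (hSmono h))
  obtain ⟨X, hX⟩ : Summable fun n => (1 / 2 : ℝ) ^ n • x n := by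
    refine Summable.of_norm_bounded summable_geometric_two fun n => ?_
    rw [norm_smul, norm_pow, Real.norm_of_nonneg (by norm_num)]
    exact mul_le_of_le_one_right (by positivity) (hx1 n)
  have hxX : ∀ n, (1 / 2 : ℝ) ^ n • x n ≤ X := fun n =>
    le_hasSum hX n fun k _ => smul_nonneg (by positivity) (hx0 k)
  have hX0 : 0 ≤ X := (smul_nonneg (by positivity) (hx0 0)).trans (hxX 0)
  have hq : ∀ n : ℕ, 0 ≤ (1 / 2 : ℝ) ^ n • X := fun n => smul_nonneg (by positivity) hX0
  let v : ℕ → G := fun n => (x n - (4 : ℝ) ^ n • S n - (1 / 2 : ℝ) ^ n • X)⁺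
  have hv0 : ∀ n, 0 ≤ v n := fun n => posPart_nonneg _
  have hvx : ∀ n, v n ≤ x n := fun n =>
    sup_le (((sub_le_self _ (hq n)).trans (sub_le_self _ (hS4 n)))) (hx0 n)
  have hv1 : ∀ n, ‖v n‖ ≤ 1 := fun n => (norm_le_of_le (hv0 n) (hvx n)).trans (hx1 n)
  have hlt : ∀ n m, n < m → v n ⊓ v m = 0 := fun n m hnm => by
    -- For `n < m`, `x n ≤ S m` gives `v m ≤ (x m - 4ᵐ x n)⁺`, and `2⁻ⁿ X ≥ 2⁻ⁿ⁻ᵐ x m ≥ 4⁻ᵐ x m`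
    -- gives `v n ≤ (x n - 4⁻ᵐ x m)⁺`.
    refine inf_eq_zero_mono (hv0 n) (hv0 m) (posPart_mono ?_) (posPart_mono ?_)
      (posPart_sub_smul_inf_eq_zero (x n) (x m) (p := (4 : ℝ) ^ m) (by positivity))
    · rw [sub_sub]
      refine sub_le_sub_left ?_ _
      refine le_trans ?_ (le_add_of_nonneg_left (hS4 n))
      refine le_trans ?_ (smul_le_smul_of_nonneg_left (hxX m) (by positivity))
      rw [smul_smul, ← pow_add]
      refine smul_le_smul_of_nonneg_right ?_ (hx0 m)
      have : ((4 : ℝ) ^ m)⁻¹ = (1 / 2) ^ (m + m) := by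
        rw [pow_add, ← mul_pow, ← inv_pow]
        norm_num
      rw [this]
      exact pow_le_pow_of_le_one (by norm_num) (by norm_num) (by lia)
    · refine (sub_le_self _ (hq m)).trans (sub_le_sub_left ?_ _)
      exact smul_le_smul_of_nonneg_left (hxS n m hnm) (by positivity)
  have hvd : ∀ n k, n ≠ k → v n ⊓ v k = 0 := fun n k hnk => by
    obtain h | h := lt_or_gt_of_ne hnk
    · exact hlt n k h
    · rw [inf_comm]; exact hlt k n h
  -- The correction that made the `v n` disjoint has norm at most `2⁻ⁿ ‖X‖`, so `T (v n)` cannot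
  -- tend to `0`.
  have hle : ∀ n, ε ≤ ‖T (v n)‖ + ‖T‖ * ((1 / 2 : ℝ) ^ n * ‖X‖) := fun n => by
    set p := x n - (4 : ℝ) ^ n • S n
    have h1 : ‖p⁺ - v n‖ ≤ (1 / 2 : ℝ) ^ n * ‖X‖ := by
      rw [← norm_abs_eq_norm]
      refine (norm_le_of_le (abs_nonneg _) (abs_posPart_sub_posPart_sub_le (hq n))).trans ?_
      rw [norm_smul, norm_pow, Real.norm_of_nonneg (by norm_num)]
    have h2 : T p⁺ = T (v n) + T (p⁺ - v n) := by rw [← map_add]; congr 1; abel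
    refine (hxε n).trans ?_
    change ‖T p⁺‖ ≤ _
    rw [h2]
    refine (norm_add_le _ _).trans (add_le_add le_rfl ((T.le_opNorm _).trans ?_))
    gcongr
  have hlim : Tendsto (fun n : ℕ => ‖T (v n)‖ + ‖T‖ * ((1 / 2 : ℝ) ^ n * ‖X‖)) atTop (𝓝 0) := by
    simpa using (hT v hv0 hv1 hvd).add (((tendsto_pow_atTop_nhds_zero_of_lt_one
      (r := (1 / 2 : ℝ)) (by norm_num) (by norm_num)).mul_const ‖X‖).const_mul ‖T‖)
  exact hε.not_ge (ge_of_tendsto' hlim hle)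

end Disjointification

/-! ### Weakly null and disjoint sequences. -/

section WeaklyNull

theorem WeaklyNull.exists_norm_le {G : Type*} [NormedAddCommGroup G] [NormedSpace ℝ G]
    {x : ℕ → G} (hx : WeaklyNull x) : ∃ C : ℝ, ∀ n, ‖x n‖ ≤ C := by
  obtain ⟨C, hC⟩ := banach_steinhaus
    (g := fun n => NormedSpace.inclusionInDoubleDual ℝ G (x n)) fun φ => by
      obtain ⟨C, hC⟩ := (hx φ).norm.bddAbove_range
      exact ⟨C, fun n => hC ⟨n, rfl⟩⟩
  refine ⟨C, fun n => ?_⟩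
  rw [← (NormedSpace.inclusionInDoubleDualLi ℝ (E := G)).norm_map (x n)]
  exact hC n

theorem WeaklyNull.map {G H : Type*} [NormedAddCommGroup G] [NormedSpace ℝ G]
    [NormedAddCommGroup H] [NormedSpace ℝ H] {x : ℕ → G} (hx : WeaklyNull x) (T : G →L[ℝ] H) :
    WeaklyNull fun n => T (x n) :=
  fun φ => hx (φ.comp T)

variable {G : Type*} [NormedAddCommGroup G] [NormedSpace ℝ G] [Lattice G] [HasSolidNorm G]
  [IsOrderedAddMonoid G] [IsOrderedModule ℝ G]

/-- A positive functional agrees on the moduli of a disjoint sequence with a continuous functional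
evaluated at the sequence. -/
theorem DisjointSeq.exists_dual_apply_eq {x : ℕ → G} (hx : DisjointSeq x) {φ : StrongDual ℝ G}
    (hφ : 0 ≤ φ) : ∃ ψ : StrongDual ℝ G, ∀ n, ψ (x n) = φ |x n| := by
  let L : (ℕ →₀ ℝ) →ₗ[ℝ] G := Finsupp.linearCombination ℝ x
  let ψ₀ : (ℕ →₀ ℝ) →ₗ[ℝ] ℝ := Finsupp.linearCombination ℝ fun n => φ |x n|
  -- By disjointness `|∑ cᵢ xᵢ| = ∑ |cᵢ| |xᵢ|`. Hence `ψ₀` descends to the span of the `x n`,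
  -- dominated there by the sublinear `z ↦ φ |z|`, and Hahn-Banach extends it.
  have hle : ∀ c, ψ₀ c ≤ φ |L c| := fun c => by
    simp only [L, ψ₀, Finsupp.linearCombination_apply, Finsupp.sum]
    rw [abs_sum_smul_of_disjoint hx, map_sum]
    refine Finset.sum_le_sum fun i _ => ?_
    rw [map_smul, smul_eq_mul, smul_eq_mul]
    exact mul_le_mul_of_nonneg_right (le_abs_self _) (apply_nonneg hφ (abs_nonneg _))
  have hker : ∀ c, L c = 0 → ψ₀ c = 0 := fun c hc => by
    refine le_antisymm (by simpa [hc] using hle c) ?_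
    simpa [hc] using hle (-c)
  obtain ⟨s, hs⟩ := L.rangeRestrict.exists_rightInverse_of_surjective L.range_rangeRestrict
  have hs' : ∀ y : L.range, L (s y) = y := fun y =>
    congrArg Subtype.val (LinearMap.congr_fun hs y)
  obtain ⟨ψ, hψ, hψle⟩ := exists_extension_of_le_sublinear ⟨L.range, ψ₀ ∘ₗ s⟩
    (fun z => φ |z|)
    (fun c hc z => by rw [abs_smul_eq, abs_of_pos hc, map_smul, smul_eq_mul])
    (fun y z => by rw [← map_add]; exact monotone_apply hφ (abs_add_le y z))
    (fun y => (hle (s y)).trans (by rw [hs' y]))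
  have hbound : ∀ z, ‖ψ z‖ ≤ ‖φ‖ * ‖z‖ := fun z => by
    have h1 : ∀ z, ψ z ≤ ‖φ‖ * ‖z‖ := fun z => (hψle z).trans <| (le_abs_self _).trans <|
      (φ.le_opNorm _).trans_eq (by rw [norm_abs_eq_norm])
    rw [Real.norm_eq_abs, abs_le']
    refine ⟨h1 z, ?_⟩
    simpa using h1 (-z)
  refine ⟨ψ.mkContinuous ‖φ‖ hbound, fun n => ?_⟩
  have hLn : L (Finsupp.single n 1) = x n := by simp [L]
  have h1 : ψ (x n) = ψ₀ (s ⟨x n, Finsupp.single n 1, hLn⟩) := hψ ⟨x n, Finsupp.single n 1, hLn⟩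
  have h2 := hker (s ⟨x n, Finsupp.single n 1, hLn⟩ - Finsupp.single n 1)
    (by rw [map_sub, hs', hLn, sub_self])
  rw [map_sub, sub_eq_zero] at h2
  rw [LinearMap.mkContinuous_apply, h1, h2]
  simp [ψ₀]

theorem WeaklyNull.abs_of_disjoint {x : ℕ → G} (hx : WeaklyNull x) (hd : DisjointSeq x) :
    WeaklyNull fun n => |x n| := by
  have key : ∀ φ : StrongDual ℝ G, 0 ≤ φ → Tendsto (fun n => φ |x n|) atTop (𝓝 0) :=
    fun φ hφ => by
      obtain ⟨ψ, hψ⟩ := hd.exists_dual_apply_eq hφ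
      exact (hx ψ).congr hψ
  intro φ
  have := (key φ⁺ (posPart_nonneg φ)).sub (key φ⁻ (negPart_nonneg φ))
  simpa only [← sub_apply, posPart_sub_negPart, sub_zero] using this

end WeaklyNull

/-- A weak* continuous linear functional on a dual space is the evaluation at a vector. -/
theorem exists_apply_eq_of_weakStar_continuous {X : Type*} [NormedAddCommGroup X]
    [NormedSpace ℝ X] (f : StrongDual ℝ X →ₗ[ℝ] ℝ)
    (hf : Continuous fun t : WeakDual ℝ X => f (WeakDual.toStrongDual t)) :
    ∃ x : X, ∀ t, f t = t x := by
  obtain ⟨x, hx⟩ := LinearMap.dualEmbedding_surjective (topDualPairing ℝ X)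
    ⟨f ∘ₗ WeakDual.toStrongDual.toLinearMap, hf⟩
  exact ⟨x, fun t => (DFunLike.congr_fun hx (StrongDual.toWeakDual t)).symm⟩

/-! ### Preadjoints of weak*-weak* continuous operators. -/

section Preadjoint

variable {E F : Type*} [NormedAddCommGroup E] [NormedSpace ℝ E] [NormedAddCommGroup F]
  [NormedSpace ℝ F]

/-- The preadjoint `F* → E*` of an operator `E** → F**`. -/
noncomputable def preadjoint
    (u : StrongDual ℝ (StrongDual ℝ E) →L[ℝ] StrongDual ℝ (StrongDual ℝ F)) :
    StrongDual ℝ F →L[ℝ] StrongDual ℝ E :=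
  (u.comp (NormedSpace.inclusionInDoubleDual ℝ E)).flip

/-- A weak*-weak* continuous operator is the adjoint of its preadjoint. -/
theorem apply_preadjoint
    {u : StrongDual ℝ (StrongDual ℝ E) →L[ℝ] StrongDual ℝ (StrongDual ℝ F)}
    (hu : Continuous fun t : WeakDual ℝ (StrongDual ℝ E) =>
      StrongDual.toWeakDual (u (WeakDual.toStrongDual t)))
    (t : StrongDual ℝ (StrongDual ℝ E)) (φ : StrongDual ℝ F) :
    t (preadjoint u φ) = u t φ := by
  -- `t ↦ u t φ` is weak* continuous, hence evaluation at some `g` in `E*`; testing on the canonical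
  -- copy of `E` identifies `g`.
  obtain ⟨g, hg'⟩ := exists_apply_eq_of_weakStar_continuous
    ((NormedSpace.inclusionInDoubleDual ℝ (StrongDual ℝ F) φ).comp u).toLinearMap
    ((WeakDual.eval_continuous φ).comp hu)
  have : preadjoint u φ = g := by
    ext x
    exact hg' (NormedSpace.inclusionInDoubleDual ℝ E x)
  rw [this]
  exact (hg' t).symm

end Preadjoint

/-! ### The linear case. -/

section Linear

variable {E F : Type*}
  [NormedAddCommGroup E] [NormedSpace ℝ E] [Lattice E] [HasSolidNorm E] [IsOrderedAddMonoid E]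
  [IsOrderedModule ℝ E]
  [NormedAddCommGroup F] [NormedSpace ℝ F] [Lattice F] [HasSolidNorm F] [IsOrderedAddMonoid F]
  [IsOrderedModule ℝ F]

theorem inclusionInDoubleDual_nonneg {x : E} (hx : 0 ≤ x) :
    0 ≤ NormedSpace.inclusionInDoubleDual ℝ E x :=
  fun _ hφ => apply_nonneg hφ hx

theorem preadjoint_nonneg
    {u : StrongDual ℝ (StrongDual ℝ E) →L[ℝ] StrongDual ℝ (StrongDual ℝ F)}
    (hu : ∀ t, 0 ≤ t → 0 ≤ u t) {φ : StrongDual ℝ F} (hφ : 0 ≤ φ) : 0 ≤ preadjoint u φ :=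
  fun _ hx => apply_nonneg (hu _ (inclusionInDoubleDual_nonneg hx)) hφ

variable [CompleteSpace F]

/-- A positive weak*-weak* continuous operator `E** → F**` with values in `F` sends positive weakly
null sequences to norm null sequences, if `E*` has the positive Schur property and the norm of `F`
is order continuous. -/
theorem tendsto_norm_apply_of_weaklyNull (hE : PositiveSchurProperty (StrongDual ℝ E))
    (hF : OrderContinuousNorm F)
    {u : StrongDual ℝ (StrongDual ℝ E) →L[ℝ] StrongDual ℝ (StrongDual ℝ F)}
    (hu0 : ∀ t, 0 ≤ t → 0 ≤ u t)
    (hugen : ∀ t, u t ∈ Set.range (NormedSpace.inclusionInDoubleDual ℝ F))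
    (hu : Continuous fun t : WeakDual ℝ (StrongDual ℝ E) =>
      StrongDual.toWeakDual (u (WeakDual.toStrongDual t)))
    {x : ℕ → StrongDual ℝ (StrongDual ℝ E)} (hx0 : ∀ n, 0 ≤ x n) (hx : WeaklyNull x) :
    Tendsto (fun n => ‖u (x n)‖) atTop (𝓝 0) := by
  have hdisj : ∀ f : ℕ → StrongDual ℝ F, (∀ n, 0 ≤ f n) → (∀ n, ‖f n‖ ≤ 1) →
      (∀ n k, n ≠ k → f n ⊓ f k = 0) →
      Tendsto (fun n => ‖preadjoint u (f n)‖) atTop (𝓝 0) := fun f hf0 hf1 hfd => by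
    refine hE _ (fun n => preadjoint_nonneg hu0 (hf0 n)) fun t => ?_
    -- Genuineness enters here: weak* nullity of `f n` can be tested only at vectors of `F`.
    obtain ⟨y, hy⟩ := hugen t
    refine (hF.tendsto_apply_of_disjoint hf0 hf1 hfd y).congr fun n => ?_
    rw [apply_preadjoint hu, ← hy, NormedSpace.dual_def]
  obtain ⟨C, hC⟩ := hx.exists_norm_le
  have hC0 : 0 ≤ C := (norm_nonneg (x 0)).trans (hC 0)
  rw [Metric.tendsto_atTop']
  intro ε hε
  -- With `‖x n‖ ≤ C`, this choice keeps the remainder below `ε / 2`; the `+ 1` covers `C = 0`.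
  obtain ⟨w, hw0, hw⟩ := exists_norm_apply_posPart_sub_lt (preadjoint u) hdisj
    (ε := ε / (2 * (C + 1))) (by positivity)
  have hlim : Tendsto (fun n => u (x n) w) atTop (𝓝 0) :=
    (hx (NormedSpace.inclusionInDoubleDual ℝ _ (preadjoint u w))).congr fun n => by
      rw [NormedSpace.dual_def, apply_preadjoint hu]
  obtain ⟨N, hN⟩ := eventually_atTop.1 (hlim.eventually_lt_const (half_pos hε))
  refine ⟨N, fun n hn => ?_⟩
  have hux := hu0 _ (hx0 n)
  have hCε : C * (ε / (2 * (C + 1))) < ε / 2 := by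
    rw [mul_div_assoc', div_lt_div_iff₀ (by positivity) two_pos]
    nlinarith
  have hle : ‖u (x n)‖ ≤ u (x n) w + C * (ε / (2 * (C + 1))) := by
    refine ContinuousLinearMap.opNorm_le_of_unit_norm
      (add_nonneg (apply_nonneg hux hw0) (by positivity)) fun φ hφ => ?_
    rw [Real.norm_eq_abs]
    refine (abs_apply_le _ φ).trans ?_
    rw [abs_of_nonneg hux]
    -- The part `w` does not depend on `φ`, and the excess is uniformly small under the preadjoint.
    have h1 : |φ| ≤ w + (|φ| - w)⁺ := by
      rw [← sub_le_iff_le_add']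
      exact le_posPart _
    refine (monotone_apply hux h1).trans ?_
    rw [map_add, ← apply_preadjoint hu _ (|φ| - w)⁺]
    gcongr
    refine (le_abs_self _).trans (((x n).le_opNorm _).trans (mul_le_mul (hC n) (hw _ (abs_nonneg φ)
      ?_).le (norm_nonneg _) hC0))
    rw [norm_abs_eq_norm, hφ]
  have := hN n hn.le
  rw [Real.dist_eq, sub_zero]
  exact (abs_of_nonneg (norm_nonneg (u (x n)))).trans_lt (by linarith)

end Linear

/-! ### Reduction to positive sequences and the bidual extension. -/

section Multilinear

variable {ι : Type*} [Fintype ι] [DecidableEq ι] {E : ι → Type*} {F : Type*}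
  [∀ i, NormedAddCommGroup (E i)] [∀ i, NormedSpace ℝ (E i)] [∀ i, Lattice (E i)]
  [∀ i, HasSolidNorm (E i)] [∀ i, IsOrderedAddMonoid (E i)] [∀ i, IsOrderedModule ℝ (E i)]
  [NormedAddCommGroup F] [NormedSpace ℝ F] [Lattice F] [HasSolidNorm F]
  [IsOrderedAddMonoid F] [IsOrderedModule ℝ F]

/-- Expanding `zᵢ = zᵢ⁺ - zᵢ⁻` in every variable gives, up to sign, the same positive terms as
expanding `|zᵢ| = zᵢ⁺ + zᵢ⁻`. -/
theorem PositiveMultilinear.abs_apply_le {A : MultilinearMap ℝ E F} (hA : PositiveMultilinear A)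
    (z : ∀ i, E i) : |A z| ≤ A fun i => |z i| := by
  have h1 : z = (fun i => (z i)⁺) + fun i => -(z i)⁻ := by
    ext i
    simp [← sub_eq_add_neg]
  have h2 : (fun i => |z i|) = (fun i => (z i)⁺) + fun i => (z i)⁻ := by
    ext i
    simp [posPart_add_negPart]
  rw [h2, A.map_add_univ]
  conv_lhs => rw [h1, A.map_add_univ]
  refine (Finset.le_sum_of_subadditive _ abs_zero.le abs_add_le _ _).trans (Finset.sum_le_sum fun s _ => ?_)
  have h3 : (s.piecewise (fun i => (z i)⁺) fun i => -(z i)⁻) = fun i =>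
      (if i ∈ s then (1 : ℝ) else -1) • s.piecewise (fun i => (z i)⁺) (fun i => (z i)⁻) i := by
    ext i
    by_cases hi : i ∈ s <;> simp [hi]
  have h4 : |∏ i, (if i ∈ s then (1 : ℝ) else -1)| = 1 := by
    rw [Finset.abs_prod]
    refine Finset.prod_eq_one fun i _ => ?_
    split_ifs <;> simp
  rw [h3, A.map_smul_univ, abs_smul_eq, h4, one_smul, abs_of_nonneg]
  refine hA _ fun i => ?_
  by_cases hi : i ∈ s
  · simp [hi]
  · simp [hi]

theorem PositiveMultilinear.norm_apply_update_le {A : MultilinearMap ℝ E F}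
    (hA : PositiveMultilinear A) (z : ∀ i, E i) (j : ι) (x : E j) :
    ‖A (Function.update z j x)‖ ≤ ‖A (Function.update (fun i => |z i|) j |x|)‖ := by
  have h : (fun i => |Function.update z j x i|) = Function.update (fun i => |z i|) j |x| := by
    ext i
    obtain rfl | hi := eq_or_ne i j
    · simp
    · simp [hi]
  rw [← h]
  exact norm_le_of_le (abs_nonneg _) (hA.abs_apply_le _) |>.trans' (norm_abs_eq_norm _).ge

/-- A positive multilinear operator is separately almost Dunford-Pettis if it sends positive weakly
null sequences to norm null sequences in each variable, the others being fixed and positive. -/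
theorem PositiveMultilinear.separatelyAlmostDunfordPettis {A : MultilinearMap ℝ E F}
    (hA : PositiveMultilinear A)
    (h : ∀ (j : ι) (z : ∀ i, E i) (x : ℕ → E j), (∀ i, 0 ≤ z i) → (∀ n, 0 ≤ x n) → WeaklyNull x →
      Tendsto (fun n => ‖A (Function.update z j (x n))‖) atTop (𝓝 0)) :
    SeparatelyAlmostDunfordPettis A := fun j z x hd hx =>
  squeeze_zero (fun _ => norm_nonneg _) (fun n => hA.norm_apply_update_le z j (x n))
    (h j _ _ (fun i => abs_nonneg (z i)) (fun n => abs_nonneg (x n)) (hx.abs_of_disjoint hd))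

end Multilinear

section BidualExtension

variable {ι : Type*} [DecidableEq ι] {E : ι → Type*} {F : Type*}
  [∀ i, NormedAddCommGroup (E i)] [∀ i, NormedSpace ℝ (E i)]
  [NormedAddCommGroup F] [NormedSpace ℝ F]

theorem IsBidualExtension.norm_apply_update {A : MultilinearMap ℝ E F}
    {B : ContinuousMultilinearMap ℝ (fun i => StrongDual ℝ (StrongDual ℝ (E i)))
      (StrongDual ℝ (StrongDual ℝ F))}
    (hBA : IsBidualExtension A B) (z : ∀ i, E i) (j : ι) (x : E j) :
    ‖B (Function.update (fun i => NormedSpace.inclusionInDoubleDual ℝ (E i) (z i)) j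
      (NormedSpace.inclusionInDoubleDual ℝ (E j) x))‖ = ‖A (Function.update z j x)‖ := by
  have h : Function.update (fun i => NormedSpace.inclusionInDoubleDual ℝ (E i) (z i)) j
      (NormedSpace.inclusionInDoubleDual ℝ (E j) x) =
      fun i => NormedSpace.inclusionInDoubleDual ℝ (E i) (Function.update z j x i) := funext fun i =>
    (Function.apply_update (fun i => NormedSpace.inclusionInDoubleDual ℝ (E i)) z j x i).symm
  rw [h, hBA]
  exact (NormedSpace.inclusionInDoubleDualLi ℝ (E := F)).norm_map _

end BidualExtension

theorem update_nonneg {ι : Type*} [DecidableEq ι] {E : ι → Type*}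
    [∀ i, AddCommGroup (E i)] [∀ i, Lattice (E i)] {z : ∀ i, E i} (hz : ∀ i, 0 ≤ z i) {j : ι}
    {x : E j} (hx : 0 ≤ x) (i : ι) : 0 ≤ Function.update z j x i := by
  obtain rfl | hi := eq_or_ne i j
  · simpa
  · simpa [hi] using hz i

end BanachLattice

theorem proposition2p4 {m : ℕ} {E : Fin m → Type*} {F : Type*}
    [∀ i, NormedAddCommGroup (E i)] [∀ i, NormedSpace ℝ (E i)] [∀ i, Lattice (E i)]
    [∀ i, HasSolidNorm (E i)] [∀ i, IsOrderedAddMonoid (E i)] [∀ i, IsOrderedModule ℝ (E i)]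
    [∀ i, CompleteSpace (E i)]
    [NormedAddCommGroup F] [NormedSpace ℝ F] [Lattice F] [HasSolidNorm F]
    [IsOrderedAddMonoid F] [IsOrderedModule ℝ F] [CompleteSpace F]
    (hE : ∀ i, BanachLattice.PositiveSchurProperty (StrongDual ℝ (E i)))
    (hF : BanachLattice.OrderContinuousNorm F)
    (A : MultilinearMap ℝ E F) (hA : BanachLattice.PositiveMultilinear A)
    (B : ContinuousMultilinearMap ℝ (fun i => StrongDual ℝ (StrongDual ℝ (E i)))
      (StrongDual ℝ (StrongDual ℝ F)))
    (hBA : BanachLattice.IsBidualExtension A B)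
    (hBpos : BanachLattice.PositiveMultilinear
      (E := fun i => StrongDual ℝ (StrongDual ℝ (E i)))
      (F := StrongDual ℝ (StrongDual ℝ F)) B.toMultilinearMap)
    (hBgen : BanachLattice.IsGenuine B)
    (hBcont : BanachLattice.SeparatelyWeakStarContinuous B) :
    BanachLattice.SeparatelyAlmostDunfordPettis
        (E := fun i => StrongDual ℝ (StrongDual ℝ (E i)))
        (F := StrongDual ℝ (StrongDual ℝ F)) B.toMultilinearMap ∧
      BanachLattice.SeparatelyAlmostDunfordPettis A := by
  have key : ∀ (j : Fin m) (z : ∀ i, StrongDual ℝ (StrongDual ℝ (E i)))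
      (x : ℕ → StrongDual ℝ (StrongDual ℝ (E j))), (∀ i, 0 ≤ z i) → (∀ n, 0 ≤ x n) →
      BanachLattice.WeaklyNull x →
      Tendsto (fun n => ‖B (Function.update z j (x n))‖) atTop (𝓝 0) :=
    fun j z x hz hx0 hx =>
      BanachLattice.tendsto_norm_apply_of_weaklyNull (u := B.toContinuousLinearMap z j) (hE j) hF
        (fun t ht => hBpos _ (BanachLattice.update_nonneg hz ht)) (fun t => hBgen _) (hBcont j z)
        hx0 hx
  refine ⟨BanachLattice.PositiveMultilinear.separatelyAlmostDunfordPettis hBpos key,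
    hA.separatelyAlmostDunfordPettis fun j z x hz hx0 hx => ?_⟩
  -- `A` inherits the property because the embeddings preserve positivity, weak nullity and norms.
  have h := key j (fun i => NormedSpace.inclusionInDoubleDual ℝ (E i) (z i))
    (fun n => NormedSpace.inclusionInDoubleDual ℝ (E j) (x n))
    (fun i => BanachLattice.inclusionInDoubleDual_nonneg (hz i))
    (fun n => BanachLattice.inclusionInDoubleDual_nonneg (hx0 n)) (hx.map _)
  exact h.congr fun n => hBA.norm_apply_update z j (x n)
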